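/- Let $(X,d)$ be a compact metric space, $T:X\to X$ a continuous map, and $\mu$ a $T$-invariant Borel probability measure on $X$. For $x,y\in X$ put $$F(x,y)=\limsup_{n\to\infty}\frac1n\min_{\sigma\in S_n}\sum_{k=0}^{n-1}d\bigl(T^kx,T^{\sigma(k)}y\bigr),$$ where $S_n$ is the set of all permutations of $\{0,1,\ldots,n-1\}$. Then $\mu$ is ergodic if and only if $$(\mu\times\mu)\bigl(\{(x,y)\in X\times X: F(x,y)=0\}\bigr)=1.$$ -/

import Mathlib

open MeasureTheory Filter

/-- `F_n(x,y) = (1/n) inf_{σ ∈ S_n} ∑_{k<n} d(T^k x, T^{σ(k)} y)`, where `S_n` is the group of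
permutations of `{0, …, n-1}`. (Meaningful for `n ≥ 1`.) -/
noncomputable def weakMeanDistN {X : Type*} [MetricSpace X] (T : X → X) (n : ℕ) (x y : X) : ℝ :=
  (1 / (n : ℝ)) * ⨅ σ : Equiv.Perm (Fin n), ∑ k : Fin n, dist (T^[(k : ℕ)] x) (T^[(σ k : ℕ)] y)

/-- The weak-mean pseudometric `F(x,y) = limsup_{n → ∞} F_n(x,y)`. On a compact space the sequence
is bounded, as it takes its values in `[0, diam X]`, so the real-valued `limsup` is the usual one. -/
noncomputable def weakMeanDist {X : Type*} [MetricSpace X] (T : X → X) (x y : X) : ℝ :=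
  limsup (fun n : ℕ => weakMeanDistN T n x y) atTop

/-! If `μ` is ergodic, cut `X` into finitely many cells of small diameter. By Birkhoff's theorem,
almost every `x` and `y` visit each cell with the same limiting frequency, so a permutation can pair
nearly all times at which the two orbits share a cell (`exists_perm_card_mismatch_le`). Hence
`F(x,y)` is at most the cell size.

Conversely, permuting times does not change a Birkhoff sum, so `F(x,y) = 0` forces the averages of
each continuous `f` along the two orbits to merge. An invariant `u` is approximated in `L¹` by such
an `f`; since `u` is its own average and averaging does not increase the `L¹` norm, `∫∫ |u(x) -
u(y)| = 0`. Indicators of invariant sets are therefore almost surely constant. This direction needs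
no ergodic theorem. -/

/-! ### Birkhoff's theorem via the maximal function -/

section Birkhoff

variable {X : Type*} {T : X → X}

/-- `max_{k ≤ N} S_k g`, defined by recursion. -/
noncomputable def birkhoffMax (T : X → X) (g : X → ℝ) : ℕ → X → ℝ
  | 0 => 0
  | N + 1 => fun x => max 0 (g x + birkhoffMax T g N (T x))

lemma birkhoffMax_succ (g : X → ℝ) (N : ℕ) (x : X) :
    birkhoffMax T g (N + 1) x = max 0 (g x + birkhoffMax T g N (T x)) := rfl

lemma birkhoffMax_nonneg (g : X → ℝ) (N : ℕ) (x : X) : 0 ≤ birkhoffMax T g N x := by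
  cases N <;> simp [birkhoffMax]

lemma birkhoffMax_le_succ (g : X → ℝ) (N : ℕ) (x : X) :
    birkhoffMax T g N x ≤ birkhoffMax T g (N + 1) x := by
  induction N generalizing x with
  | zero => simp [birkhoffMax]
  | succ N ih =>
    rw [birkhoffMax_succ, birkhoffMax_succ]
    gcongr
    exact ih _

lemma birkhoffSum_le_birkhoffMax (g : X → ℝ) (N : ℕ) (x : X) :
    birkhoffSum T g N x ≤ birkhoffMax T g N x := by
  induction N generalizing x with
  | zero => simp [birkhoffMax]
  | succ N ih =>
    rw [birkhoffSum_succ', birkhoffMax_succ]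
    exact le_max_of_le_right (by gcongr; exact ih _)

lemma birkhoffAverage_real (g : X → ℝ) (n : ℕ) (x : X) :
    birkhoffAverage ℝ T g n x = (n : ℝ)⁻¹ * birkhoffSum T g n x := rfl

lemma abs_birkhoffAverage_le (h : X → ℝ) (n : ℕ) (x : X) :
    |birkhoffAverage ℝ T h n x| ≤ birkhoffAverage ℝ T (fun x => |h x|) n x := by
  rw [birkhoffAverage_real, birkhoffAverage_real, abs_mul, abs_of_nonneg (by positivity)]
  exact mul_le_mul_of_nonneg_left (Finset.abs_sum_le_sum_abs _ _) (by positivity)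

lemma birkhoffSum_indicator_one {ι : Type*} [DecidableEq ι] (a : X → ι) (i : ι) (n : ℕ) (x : X) :
    birkhoffSum T ((a ⁻¹' {i}).indicator (1 : X → ℝ)) n x =
      ((Finset.univ.filter fun k : Fin n => a (T^[(k : ℕ)] x) = i).card : ℝ) := by
  rw [birkhoffSum, Finset.sum_range, ← Finset.sum_boole]
  exact Finset.sum_congr rfl fun k _ => by
    by_cases h : a (T^[(k : ℕ)] x) = i <;> simp [h]

variable [MeasurableSpace X] {μ : Measure X}

lemma MeasureTheory.MeasurePreserving.integral_comp_self (hT : MeasurePreserving T μ μ)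
    {h : X → ℝ} (hh : Integrable h μ) : ∫ x, h (T x) ∂μ = ∫ x, h x ∂μ := by
  have := integral_map (μ := μ) hT.aemeasurable (f := h)
    (by rw [hT.map_eq]; exact hh.aestronglyMeasurable)
  rw [hT.map_eq] at this
  exact this.symm

lemma integrable_birkhoffAverage (hT : MeasurePreserving T μ μ) {h : X → ℝ} (hh : Integrable h μ)
    (n : ℕ) : Integrable (birkhoffAverage ℝ T h n) μ :=
  (integrable_finsetSum _ fun k _ => (hT.iterate k).integrable_comp_of_integrable hh).const_mul
    (n : ℝ)⁻¹

lemma integral_birkhoffAverage (hT : MeasurePreserving T μ μ) {h : X → ℝ} (hh : Integrable h μ)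
    {n : ℕ} (hn : 0 < n) : ∫ x, birkhoffAverage ℝ T h n x ∂μ = ∫ x, h x ∂μ := by
  have hn0 : (n : ℝ) ≠ 0 := (Nat.cast_pos.2 hn).ne'
  simp_rw [birkhoffAverage_real, birkhoffSum]
  have hk (k : ℕ) : Integrable (fun x => h (T^[k] x)) μ :=
    (hT.iterate k).integrable_comp_of_integrable hh
  rw [integral_const_mul, integral_finsetSum _ fun k _ => hk k]
  simp_rw [fun k => (hT.iterate k).integral_comp_self hh]
  simp [hn0]

lemma integrable_birkhoffMax (hT : MeasurePreserving T μ μ) {g : X → ℝ} (hg : Integrable g μ)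
    (N : ℕ) : Integrable (birkhoffMax T g N) μ := by
  induction N with
  | zero => exact integrable_zero _ _ _
  | succ N ih =>
    exact (integrable_zero X ℝ μ).sup (hg.add (hT.integrable_comp_of_integrable ih))

lemma measurable_birkhoffSum (hT : Measurable T) {g : X → ℝ} (hg : Measurable g) (n : ℕ) :
    Measurable (birkhoffSum T g n) :=
  Finset.measurable_fun_sum _ fun k _ => hg.comp (hT.iterate k)

/-- If the Birkhoff sums of `g` are almost everywhere unbounded above, then `∫ g ≥ 0`. -/
lemma integral_nonneg_of_birkhoffSum_unbounded (hT : MeasurePreserving T μ μ) {g : X → ℝ}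
    (hg : Integrable g μ) (hu : ∀ᵐ x ∂μ, ∀ C : ℕ, ∃ n, (C : ℝ) < birkhoffSum T g n x) :
    0 ≤ ∫ x, g x ∂μ := by
  have hint := integrable_birkhoffMax hT hg
  have hint' (N : ℕ) : Integrable (fun x => birkhoffMax T g N (T x)) μ :=
    hT.integrable_comp_of_integrable (hint N)
  have hnonneg (N : ℕ) :
      0 ≤ ∫ x, (birkhoffMax T g (N + 1) x - birkhoffMax T g N (T x)) ∂μ := by
    rw [integral_sub (hint _) (hint' N)]
    rw [hT.integral_comp_self (hint N), sub_nonneg]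
    exact integral_mono (hint _) (hint _) (birkhoffMax_le_succ g N)
  have hlim : Tendsto (fun N => ∫ x, (birkhoffMax T g (N + 1) x - birkhoffMax T g N (T x)) ∂μ)
      atTop (nhds (∫ x, g x ∂μ)) := by
    refine tendsto_integral_of_dominated_convergence (fun x => |g x|)
      (fun N => ((hint _).sub (hint' N)).aestronglyMeasurable) hg.abs ?_ ?_
    -- With `b = birkhoffMax T g N (T x) ≥ 0`, the integrand is `max (-b) (g x)`, of size at most
    -- `|g x|`.
    · intro N
      filter_upwards with x
      have h0 := birkhoffMax_nonneg (T := T) g N (T x)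
      rw [birkhoffMax_succ, Real.norm_eq_abs, abs_le]
      have := neg_abs_le (g x)
      have := le_abs_self (g x)
      have := abs_nonneg (g x)
      constructor
      · linarith [le_max_right 0 (g x + birkhoffMax T g N (T x))]
      · rw [sub_le_iff_le_add]
        exact max_le (by linarith) (by linarith)
    -- Once some sum at `T x` exceeds `|g x|`, the outer maximum with `0` is inactive and the
    -- integrand equals `g x`.
    · filter_upwards [hT.quasiMeasurePreserving.ae hu] with x hx
      obtain ⟨C, hC⟩ := exists_nat_gt (|g x|)
      obtain ⟨n, hn⟩ := hx C
      refine tendsto_const_nhds.congr' ?_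
      filter_upwards [eventually_ge_atTop n] with N hN
      have h1 := birkhoffSum_le_birkhoffMax (T := T) g n (T x)
      have h2 : birkhoffMax T g n (T x) ≤ birkhoffMax T g N (T x) :=
        monotone_nat_of_le_succ (fun m => birkhoffMax_le_succ g m (T x)) hN
      have := neg_abs_le (g x)
      rw [birkhoffMax_succ, max_eq_right (by linarith)]
      ring
  exact ge_of_tendsto' hlim hnonneg

/-- The set of unbounded sums is strictly invariant, hence null or conull; conull would force `∫ g ≥
0`. -/
lemma Ergodic.birkhoffSum_bddAbove (hT : Ergodic T μ) {g : X → ℝ} (hgm : Measurable g)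
    (hg : Integrable g μ) (hneg : ∫ x, g x ∂μ < 0) :
    ∀ᵐ x ∂μ, ∃ C : ℕ, ∀ n, birkhoffSum T g n x ≤ C := by
  have hinv : T ⁻¹' {x | ∀ C : ℕ, ∃ n, (C : ℝ) < birkhoffSum T g n x} =
      {x | ∀ C : ℕ, ∃ n, (C : ℝ) < birkhoffSum T g n x} := by
    ext x
    simp only [Set.mem_preimage, Set.mem_ofPred_eq]
    constructor
    · intro h C
      obtain ⟨K, hK⟩ := exists_nat_gt (C - g x)
      obtain ⟨n, hn⟩ := h K
      exact ⟨n + 1, by rw [birkhoffSum_succ']; linarith⟩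
    · intro h C
      obtain ⟨K, hK⟩ := exists_nat_gt (C + |g x|)
      obtain ⟨n, hn⟩ := h K
      have := le_abs_self (g x)
      cases n with
      | zero =>
        rw [birkhoffSum_zero] at hn
        have := K.cast_nonneg (α := ℝ)
        linarith
      | succ n => exact ⟨n, by rw [birkhoffSum_succ'] at hn; linarith⟩
  have hmeas : MeasurableSet {x | ∀ C : ℕ, ∃ n, (C : ℝ) < birkhoffSum T g n x} := by
    simp only [Set.ofPred_forall, Set.ofPred_exists]
    exact MeasurableSet.iInter fun C => MeasurableSet.iUnion fun n =>
      measurableSet_lt measurable_const (measurable_birkhoffSum hT.measurable hgm n)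
  rcases hT.toPreErgodic.ae_mem_or_ae_notMem hmeas hinv with h | h
  · exact absurd (integral_nonneg_of_birkhoffSum_unbounded hT.toMeasurePreserving hg h)
      (not_le.2 hneg)
  · filter_upwards [h] with x hx
    simpa using hx

variable [IsProbabilityMeasure μ]

lemma Ergodic.birkhoffAverage_eventually_lt (hT : Ergodic T μ) {g : X → ℝ} (hgm : Measurable g)
    (hg : Integrable g μ) {ε : ℝ} (hε : 0 < ε) :
    ∀ᵐ x ∂μ, ∀ᶠ n : ℕ in atTop, birkhoffAverage ℝ T g n x < ∫ x, g x ∂μ + ε := by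
  -- `g - c` has negative mean, so its sums are bounded by some `C`, and the averages of `g` by `c +
  -- C / n`.
  set c := ∫ x, g x ∂μ + ε / 2 with hc
  have hneg : ∫ x, (g x - c) ∂μ < 0 := by
    rw [integral_sub hg (integrable_const c)]
    simp [hc]; linarith
  filter_upwards [hT.birkhoffSum_bddAbove (hgm.sub_const c) (hg.sub (integrable_const c)) hneg]
    with x ⟨C, hC⟩
  have hlim : Tendsto (fun n : ℕ => (C : ℝ) / n) atTop (nhds 0) :=
    tendsto_const_div_atTop_nhds_zero_nat _
  filter_upwards [hlim.eventually_lt_const (half_pos hε), eventually_gt_atTop 0] with n hn hpos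
  have hn0 : (0 : ℝ) < n := Nat.cast_pos.2 hpos
  have hS : birkhoffSum T (fun x => g x - c) n x = birkhoffSum T g n x - n * c := by
    simp [birkhoffSum]
  have h1 := hC n
  rw [hS] at h1
  rw [div_lt_iff₀ hn0] at hn
  rw [birkhoffAverage_real, inv_mul_lt_iff₀ hn0]
  nlinarith

/-- **Birkhoff's pointwise ergodic theorem** for an ergodic map and an integrable function. -/
theorem Ergodic.tendsto_birkhoffAverage (hT : Ergodic T μ) {g : X → ℝ} (hgm : Measurable g)
    (hg : Integrable g μ) :
    ∀ᵐ x ∂μ, Tendsto (fun n => birkhoffAverage ℝ T g n x) atTop (nhds (∫ x, g x ∂μ)) := by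
  have h1 : ∀ᵐ x ∂μ, ∀ m : ℕ, ∀ᶠ n : ℕ in atTop,
      birkhoffAverage ℝ T g n x < ∫ x, g x ∂μ + 1 / ((m : ℝ) + 1) :=
    ae_all_iff.2 fun m => hT.birkhoffAverage_eventually_lt hgm hg Nat.one_div_pos_of_nat
  have h2 : ∀ᵐ x ∂μ, ∀ m : ℕ, ∀ᶠ n : ℕ in atTop,
      birkhoffAverage ℝ T (-g) n x < ∫ x, (-g) x ∂μ + 1 / ((m : ℝ) + 1) :=
    ae_all_iff.2 fun m => hT.birkhoffAverage_eventually_lt hgm.neg hg.neg Nat.one_div_pos_of_nat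
  filter_upwards [h1, h2] with x hx1 hx2
  rw [Metric.tendsto_nhds]
  intro ε hε
  obtain ⟨m, hm⟩ := exists_nat_one_div_lt hε
  filter_upwards [hx1 m, hx2 m] with n ha hb
  have hb' : birkhoffAverage ℝ T (-g) n x = - birkhoffAverage ℝ T g n x := by
    simp [birkhoffAverage_neg]
  rw [hb'] at hb
  simp only [Pi.neg_apply, integral_neg] at hb
  rw [Real.dist_eq, abs_lt]
  constructor <;> linarith

end Birkhoff

/-! ### Matching labels by a permutation -/

section Matching

/-- Two labellings of a finite set can be matched, by a permutation, up to as many errors as the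
label counts differ. -/
lemma exists_perm_card_mismatch_le {α ι : Type*} [Fintype α] [Fintype ι] [DecidableEq ι]
    (a b : α → ι) :
    ∃ σ : Equiv.Perm α, ((Finset.univ.filter fun k => a k ≠ b (σ k)).card : ℝ) ≤
      ∑ i, |((Finset.univ.filter fun k => a k = i).card : ℝ) -
        ((Finset.univ.filter fun k => b k = i).card : ℝ)| := by
  classical
  obtain ⟨σ, hσ⟩ := Finite.exists_max
    fun σ : Equiv.Perm α => (Finset.univ.filter fun k => a k = b (σ k)).card
  -- Otherwise swapping `k` and `l` would repair `k` and lose no match, against maximality of `σ`.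
  have key (k l : α) (hk : a k ≠ b (σ k)) (hl : a l ≠ b (σ l)) : a k ≠ b (σ l) := by
    intro h
    refine absurd (hσ (σ * Equiv.swap k l)) (not_le.2 (Finset.card_lt_card ?_))
    rw [Finset.ssubset_iff]
    refine ⟨k, by simpa using hk, fun m hm => ?_⟩
    rcases Finset.mem_insert.1 hm with rfl | hm
    · exact Finset.mem_filter.2 ⟨Finset.mem_univ _, by simpa using h⟩
    · have hm' : a m = b (σ m) := by simpa using hm
      have h1 : m ≠ k := by rintro rfl; exact hk hm'
      have h2 : m ≠ l := by rintro rfl; exact hl hm'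
      exact Finset.mem_filter.2 ⟨Finset.mem_univ _, by
        simpa [Equiv.swap_apply_of_ne_of_ne h1 h2] using hm'⟩
  refine ⟨σ, ?_⟩
  rw [Finset.card_eq_sum_card_fiberwise (f := a) (t := Finset.univ) (fun _ _ => Finset.mem_univ _),
    Nat.cast_sum]
  refine Finset.sum_le_sum fun i _ => ?_
  rcases Finset.eq_empty_or_nonempty
    ((Finset.univ.filter fun k => a k ≠ b (σ k)).filter fun k => a k = i) with h | ⟨k, hk⟩
  · rw [h]; simp
  simp only [Finset.mem_filter, Finset.mem_univ, true_and] at hk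
  obtain ⟨hk, rfl⟩ := hk
  have hb : (Finset.univ.filter fun l => b l = a k).card =
      (Finset.univ.filter fun l => b (σ l) = a k).card := by
    symm
    refine Finset.card_bij (fun l _ => σ l) (by simp) (fun _ _ _ _ h => σ.injective h) ?_
    intro l hl
    exact ⟨σ.symm l, by simpa using hl, by simp⟩
  -- A label with a mismatch on the `a` side has all its `b` occurrences matched, so its mismatches
  -- number at most the count difference.
  have hle : (Finset.univ.filter fun l => b (σ l) = a k).card ≤
      ((Finset.univ.filter fun l => a l = a k).filter fun l => ¬ a l ≠ b (σ l)).card := by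
    refine Finset.card_le_card fun l hl => ?_
    simp only [Finset.mem_filter, Finset.mem_univ, true_and] at hl ⊢
    by_cases hm : a l = b (σ l)
    · exact ⟨hm.trans hl, not_not.2 hm⟩
    · exact absurd hl.symm (key k l hk hm)
  have hsplit := Finset.card_filter_add_card_filter_not
    (s := Finset.univ.filter fun l => a l = a k) (fun l => a l ≠ b (σ l))
  rw [Finset.filter_comm, hb]
  refine le_trans ?_ (le_abs_self _)
  rw [le_sub_iff_add_le, ← hsplit]
  push_cast
  gcongr

end Matching

/-! ### Ergodicity implies zero distance -/

section WeakMean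

variable {X : Type*} [MetricSpace X] {T : X → X}

lemma weakMeanDistN_nonneg (n : ℕ) (x y : X) : 0 ≤ weakMeanDistN T n x y :=
  mul_nonneg (by positivity) (Real.iInf_nonneg fun _ => Finset.sum_nonneg fun _ _ => dist_nonneg)

lemma weakMeanDistN_le (n : ℕ) (x y : X) (σ : Equiv.Perm (Fin n)) :
    weakMeanDistN T n x y ≤
      (1 / (n : ℝ)) * ∑ k : Fin n, dist (T^[(k : ℕ)] x) (T^[(σ k : ℕ)] y) :=
  mul_le_mul_of_nonneg_left (ciInf_le (Set.finite_range _).bddBelow σ) (by positivity)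

lemma weakMeanDistN_le_of_partition {ι : Type*} [Fintype ι] {a : X → ι} {ε D : ℝ}
    (ha : ∀ x y, a x = a y → dist x y ≤ ε) (hε : 0 ≤ ε) (hD : ∀ x y : X, dist x y ≤ D)
    {n : ℕ} (hn : 0 < n) (x y : X) :
    weakMeanDistN T n x y ≤ ε + D * ∑ i,
      |birkhoffAverage ℝ T ((a ⁻¹' {i}).indicator (1 : X → ℝ)) n x -
        birkhoffAverage ℝ T ((a ⁻¹' {i}).indicator (1 : X → ℝ)) n y| := by
  classical
  have hn0 : (0 : ℝ) < n := Nat.cast_pos.2 hn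
  have hD0 : 0 ≤ D := (dist_nonneg (x := x) (y := x)).trans (hD x x)
  obtain ⟨σ, hσ⟩ := exists_perm_card_mismatch_le
    (fun k : Fin n => a (T^[(k : ℕ)] x)) (fun k : Fin n => a (T^[(k : ℕ)] y))
  refine (weakMeanDistN_le n x y σ).trans ?_
  have h1 : ∑ k : Fin n, dist (T^[(k : ℕ)] x) (T^[(σ k : ℕ)] y) ≤
      ∑ k : Fin n, (ε + if a (T^[(k : ℕ)] x) ≠ a (T^[(σ k : ℕ)] y) then D else 0) := by
    refine Finset.sum_le_sum fun k _ => ?_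
    split_ifs with h
    · linarith [hD (T^[(k : ℕ)] x) (T^[(σ k : ℕ)] y)]
    · simpa using ha _ _ (not_not.1 h)
  rw [Finset.sum_add_distrib, ← Finset.sum_filter, Finset.sum_const, Finset.sum_const,
    Finset.card_univ, Fintype.card_fin, nsmul_eq_mul, nsmul_eq_mul] at h1
  have h2 : ∑ i, |birkhoffAverage ℝ T ((a ⁻¹' {i}).indicator (1 : X → ℝ)) n x -
        birkhoffAverage ℝ T ((a ⁻¹' {i}).indicator (1 : X → ℝ)) n y| = (1 / (n : ℝ)) *
      ∑ i, |((Finset.univ.filter fun k : Fin n => a (T^[(k : ℕ)] x) = i).card : ℝ) -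
        ((Finset.univ.filter fun k : Fin n => a (T^[(k : ℕ)] y) = i).card : ℝ)| := by
    rw [Finset.mul_sum]
    refine Finset.sum_congr rfl fun i _ => ?_
    rw [birkhoffAverage_real, birkhoffAverage_real, birkhoffSum_indicator_one,
      birkhoffSum_indicator_one, ← mul_sub, abs_mul, abs_of_nonneg (by positivity), one_div]
  rw [h2]
  have h3 := h1.trans (add_le_add_right (mul_le_mul_of_nonneg_right hσ hD0) _)
  refine (mul_le_mul_of_nonneg_left h3 (by positivity)).trans_eq ?_
  field_simp

/-- A compact metric space has finite measurable partitions into small cells. -/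
lemma exists_measurable_partition [CompactSpace X] [MeasurableSpace X] [BorelSpace X]
    {ε : ℝ} (hε : 0 < ε) :
    ∃ (m : ℕ) (a : X → Fin m), Measurable a ∧ ∀ x y, a x = a y → dist x y ≤ ε := by
  obtain ⟨t, -, ht, hcov⟩ := finite_cover_balls_of_compact (X := X) isCompact_univ (half_pos hε)
  have := ht.fintype
  classical
  -- A point is labelled by the set of covering balls containing it; equal labels share a ball.
  let b : X → t → Prop := fun x p => x ∈ Metric.ball (p : X) (ε / 2)
  have hb : Measurable b := measurable_pi_iff.2 fun p =>
    measurableSet_setOfPred.1 (Metric.isOpen_ball (x := (p : X)) (ε := ε / 2)).measurableSet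
  have he : Measurable (Fintype.equivFin (t → Prop)) := Measurable.of_discrete
  refine ⟨_, _, he.comp hb, fun x y hxy => ?_⟩
  have hxy : b x = b y := (Fintype.equivFin (t → Prop)).injective hxy
  obtain ⟨p, hp, hxp⟩ := Set.mem_iUnion₂.1 (hcov (Set.mem_univ x))
  have hyp : y ∈ Metric.ball p (ε / 2) := by
    have h : b x ⟨p, hp⟩ = b y ⟨p, hp⟩ := congrFun hxy ⟨p, hp⟩
    exact h.mp hxp
  rw [Metric.mem_ball] at hxp hyp
  linarith [dist_triangle_right x y p]

variable [CompactSpace X]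

lemma dist_le_diam_univ (x y : X) : dist x y ≤ Metric.diam (Set.univ : Set X) :=
  Metric.dist_le_diam_of_mem isCompact_univ.isBounded (Set.mem_univ x) (Set.mem_univ y)

variable [MeasurableSpace X] [BorelSpace X] {μ : Measure X}
  [IsProbabilityMeasure μ]

lemma Ergodic.ae_weakMeanDist_eq_zero (hT : Ergodic T μ) :
    ∀ᵐ p ∂μ.prod μ, weakMeanDist T p.1 p.2 = 0 := by
  choose m a ham ha using fun j : ℕ =>
    exists_measurable_partition (X := X) (Nat.one_div_pos_of_nat (α := ℝ) (n := j))
  have hae : ∀ᵐ x ∂μ, ∀ (j : ℕ) (i : Fin (m j)), Tendsto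
      (fun n => birkhoffAverage ℝ T ((a j ⁻¹' {i}).indicator (1 : X → ℝ)) n x) atTop
      (nhds (∫ x, (a j ⁻¹' {i}).indicator (1 : X → ℝ) x ∂μ)) := by
    refine ae_all_iff.2 fun j => ae_all_iff.2 fun i => ?_
    have hs : MeasurableSet (a j ⁻¹' {i}) := ham j (measurableSet_singleton i)
    exact hT.tendsto_birkhoffAverage (measurable_one.indicator hs)
      ((integrable_const (1 : ℝ)).indicator hs)
  filter_upwards [Measure.quasiMeasurePreserving_fst.ae hae,
    Measure.quasiMeasurePreserving_snd.ae hae] with p hx hy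
  refine Tendsto.limsup_eq ?_
  rw [Metric.tendsto_nhds]
  intro ε hε
  obtain ⟨j, hj⟩ := exists_nat_one_div_lt hε
  have hlim : Tendsto (fun n => 1 / ((j : ℝ) + 1) + Metric.diam (Set.univ : Set X) * ∑ i,
      |birkhoffAverage ℝ T ((a j ⁻¹' {i}).indicator (1 : X → ℝ)) n p.1 -
        birkhoffAverage ℝ T ((a j ⁻¹' {i}).indicator (1 : X → ℝ)) n p.2|) atTop
      (nhds (1 / ((j : ℝ) + 1))) := by
    have h := (tendsto_finsetSum Finset.univ fun i (_ : i ∈ Finset.univ) =>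
      ((hx j i).sub (hy j i)).abs).const_mul (Metric.diam (Set.univ : Set X)) |>.const_add
        (1 / ((j : ℝ) + 1))
    simpa using h
  filter_upwards [hlim.eventually_lt_const hj, eventually_gt_atTop 0] with n hlt hn
  rw [Real.dist_0_eq_abs, abs_of_nonneg (weakMeanDistN_nonneg n _ _)]
  exact (weakMeanDistN_le_of_partition (ha j) (by positivity) dist_le_diam_univ hn _ _).trans_lt hlt

end WeakMean

/-! ### Zero distance implies ergodicity -/

section Converse

variable {X : Type*} [MetricSpace X] {T : X → X}

lemma continuous_weakMeanDistN (hT : Continuous T) (n : ℕ) :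
    Continuous fun p : X × X => weakMeanDistN T n p.1 p.2 := by
  unfold weakMeanDistN
  refine continuous_const.mul ?_
  have h (p : X × X) : (⨅ σ : Equiv.Perm (Fin n),
      ∑ k : Fin n, dist (T^[(k : ℕ)] p.1) (T^[(σ k : ℕ)] p.2)) =
      Finset.univ.inf' Finset.univ_nonempty fun σ : Equiv.Perm (Fin n) =>
        ∑ k : Fin n, dist (T^[(k : ℕ)] p.1) (T^[(σ k : ℕ)] p.2) :=
    (Finset.inf'_univ_eq_ciInf _).symm
  simp_rw [h]
  refine Continuous.finset_inf'_apply _ fun σ _ => continuous_finsetSum _ fun k _ => ?_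
  exact ((hT.iterate k).comp continuous_fst).dist ((hT.iterate (σ k)).comp continuous_snd)

/-- Reindex the sum at `y` by an optimal permutation and compare term by term. -/
lemma abs_birkhoffAverage_sub_le {f : X → ℝ} {ε K : ℝ}
    (hf : ∀ x y, |f x - f y| ≤ ε + K * dist x y) {n : ℕ} (hn : 0 < n) (x y : X) :
    |birkhoffAverage ℝ T f n x - birkhoffAverage ℝ T f n y| ≤ ε + K * weakMeanDistN T n x y := by
  have hn0 : (0 : ℝ) < n := Nat.cast_pos.2 hn
  obtain ⟨σ, hσ⟩ := exists_eq_ciInf_of_finite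
    (f := fun σ : Equiv.Perm (Fin n) => ∑ k : Fin n, dist (T^[(k : ℕ)] x) (T^[(σ k : ℕ)] y))
  have h1 : birkhoffSum T f n x - birkhoffSum T f n y =
      ∑ k : Fin n, (f (T^[(k : ℕ)] x) - f (T^[(σ k : ℕ)] y)) := by
    rw [birkhoffSum, birkhoffSum, Finset.sum_range, Finset.sum_range, Finset.sum_sub_distrib,
      Equiv.sum_comp σ fun k : Fin n => f (T^[(k : ℕ)] y)]
  have h2 : |birkhoffSum T f n x - birkhoffSum T f n y| ≤
      n * ε + K * ∑ k : Fin n, dist (T^[(k : ℕ)] x) (T^[(σ k : ℕ)] y) := by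
    rw [h1]
    refine (Finset.abs_sum_le_sum_abs _ _).trans
      ((Finset.sum_le_sum fun k _ => hf _ _).trans_eq ?_)
    simp [Finset.sum_add_distrib, Finset.mul_sum]
  rw [birkhoffAverage_real, birkhoffAverage_real, ← mul_sub, abs_mul,
    abs_of_nonneg (by positivity), weakMeanDistN, ← hσ, inv_mul_le_iff₀ hn0]
  refine h2.trans_eq ?_
  field_simp

lemma weakMeanDistN_le_bound {D : ℝ} (hD : ∀ x y : X, dist x y ≤ D) (n : ℕ) (x y : X) :
    weakMeanDistN T n x y ≤ D := by
  have hD0 : 0 ≤ D := (dist_nonneg (x := x) (y := x)).trans (hD x x)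
  refine (weakMeanDistN_le n x y 1).trans ?_
  refine (mul_le_mul_of_nonneg_left (Finset.sum_le_sum fun k _ => hD _ _)
    (by positivity)).trans ?_
  rcases n.eq_zero_or_pos with rfl | hn
  · simpa using hD0
  · have hn0 : (0 : ℝ) < n := Nat.cast_pos.2 hn
    simp [hn0.ne']

variable [CompactSpace X]

lemma tendsto_weakMeanDistN {x y : X} (h : weakMeanDist T x y = 0) :
    Tendsto (fun n => weakMeanDistN T n x y) atTop (nhds 0) := by
  have hb : IsBoundedUnder (· ≤ ·) atTop fun n => weakMeanDistN T n x y :=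
    isBoundedUnder_of ⟨_, fun n => weakMeanDistN_le_bound dist_le_diam_univ n x y⟩
  have hb' : IsBoundedUnder (· ≥ ·) atTop fun n => weakMeanDistN T n x y :=
    isBoundedUnder_of ⟨0, fun n => weakMeanDistN_nonneg n x y⟩
  exact tendsto_of_le_liminf_of_limsup_le
    (le_liminf_of_le hb.isCoboundedUnder_ge (.of_forall fun n => weakMeanDistN_nonneg n x y))
    h.le hb hb'

/-- A continuous function on a compact space is Lipschitz up to an arbitrarily small error. -/
lemma exists_abs_sub_le_add_mul_dist {f : X → ℝ} (hf : Continuous f) {ε : ℝ} (hε : 0 < ε) :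
    ∃ K : ℝ, ∀ x y, |f x - f y| ≤ ε + K * dist x y := by
  obtain ⟨δ, hδ, h⟩ := Metric.uniformContinuous_iff.1
    (CompactSpace.uniformContinuous_of_continuous hf) ε hε
  obtain ⟨M, hM⟩ := isCompact_univ.exists_bound_of_continuousOn hf.continuousOn
  have hM (x : X) : |f x| ≤ M := hM x (Set.mem_univ x)
  -- At distance at least `δ`, this slope absorbs the trivial bound `2 * M`.
  refine ⟨2 * M / δ, fun x y => ?_⟩
  have hM0 : 0 ≤ M := (abs_nonneg _).trans (hM x)
  rcases lt_or_ge (dist x y) δ with hlt | hge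
  · have := h hlt
    rw [Real.dist_eq] at this
    have : 0 ≤ 2 * M / δ * dist x y := by positivity
    linarith
  · have h1 : 2 * M ≤ 2 * M / δ * dist x y := by
      rw [div_mul_eq_mul_div, le_div_iff₀ hδ]
      gcongr
    linarith [abs_sub (f x) (f y), hM x, hM y]

lemma tendsto_birkhoffAverage_sub {f : X → ℝ} (hf : Continuous f) {x y : X}
    (h : weakMeanDist T x y = 0) :
    Tendsto (fun n => birkhoffAverage ℝ T f n x - birkhoffAverage ℝ T f n y) atTop (nhds 0) := by
  rw [Metric.tendsto_nhds]
  intro ε hε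
  obtain ⟨K, hK⟩ := exists_abs_sub_le_add_mul_dist hf (half_pos hε)
  have hlim := ((tendsto_weakMeanDistN h).const_mul K).const_add (ε / 2)
  rw [mul_zero, add_zero] at hlim
  filter_upwards [hlim.eventually_lt_const (half_lt_self hε), eventually_gt_atTop 0] with n hlt hn
  rw [Real.dist_0_eq_abs]
  exact (abs_birkhoffAverage_sub_le hK hn x y).trans_lt hlt

variable [MeasurableSpace X] [BorelSpace X] {μ : Measure X}

lemma measurableSet_weakMeanDist_eq_zero (hT : Continuous T) :
    MeasurableSet {p : X × X | weakMeanDist T p.1 p.2 = 0} :=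
  measurableSet_eq_fun
    (Measurable.limsup fun n => (continuous_weakMeanDistN hT n).measurable) measurable_const

variable [IsProbabilityMeasure μ]

lemma tendsto_integral_abs_birkhoffAverage_sub (hT : Continuous T)
    (hF : ∀ᵐ p ∂μ.prod μ, weakMeanDist T p.1 p.2 = 0) {f : X → ℝ} (hf : Continuous f) :
    Tendsto (fun n => ∫ p : X × X,
      |birkhoffAverage ℝ T f n p.1 - birkhoffAverage ℝ T f n p.2| ∂μ.prod μ) atTop (nhds 0) := by
  obtain ⟨K, hK⟩ := exists_abs_sub_le_add_mul_dist hf one_pos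
  have hcont (n : ℕ) : Continuous (birkhoffAverage ℝ T f n) :=
    continuous_const.mul (continuous_finsetSum _ fun k _ => hf.comp (hT.iterate k))
  have hcont2 (n : ℕ) : Continuous fun p : X × X =>
      |birkhoffAverage ℝ T f n p.1 - birkhoffAverage ℝ T f n p.2| :=
    (((hcont n).comp continuous_fst).sub ((hcont n).comp continuous_snd)).abs
  rw [← integral_zero (X × X) ℝ (μ := μ.prod μ)]
  refine tendsto_integral_of_dominated_convergence
    (fun _ => 1 + |K| * Metric.diam (Set.univ : Set X))
    (fun n => (hcont2 n).aestronglyMeasurable) (integrable_const _) ?_ ?_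
  · intro n
    refine .of_forall fun p => ?_
    rw [Real.norm_eq_abs, abs_abs]
    rcases n.eq_zero_or_pos with rfl | hn
    · simp only [birkhoffAverage_zero, sub_zero, abs_zero]
      have := Metric.diam_nonneg (s := (Set.univ : Set X))
      positivity
    · refine (abs_birkhoffAverage_sub_le hK hn p.1 p.2).trans ?_
      have h1 := weakMeanDistN_nonneg (T := T) n p.1 p.2
      have h2 := weakMeanDistN_le_bound (T := T) dist_le_diam_univ n p.1 p.2
      gcongr
      exact le_abs_self K
  · filter_upwards [hF] with p hp
    simpa using (tendsto_birkhoffAverage_sub hf hp).abs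

/-- An integrable invariant function takes almost surely the same value at two independent points
whose weak-mean distance is almost surely zero. -/
lemma ae_eq_of_invariant (hT : Continuous T) (hμ : MeasurePreserving T μ μ)
    (hF : ∀ᵐ p ∂μ.prod μ, weakMeanDist T p.1 p.2 = 0) {u : X → ℝ} (hu : Integrable u μ)
    (hinv : u ∘ T = u) : ∀ᵐ p ∂μ.prod μ, u p.1 = u p.2 := by
  have hint : Integrable (fun p : X × X => |u p.1 - u p.2|) (μ.prod μ) :=
    ((hu.comp_fst μ).sub (hu.comp_snd μ)).abs
  have hle : ∫ p : X × X, |u p.1 - u p.2| ∂μ.prod μ ≤ 0 := by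
    refine le_of_forall_pos_le_add fun ε hε => ?_
    obtain ⟨f, hfε, hfi⟩ := hu.exists_boundedContinuous_integral_sub_le (half_pos hε)
    have hh : Integrable (fun x => |u x - f x|) μ := (hu.sub hfi).abs
    have hA (n : ℕ) : Integrable (birkhoffAverage ℝ T (fun x => |u x - f x|) n) μ :=
      integrable_birkhoffAverage hμ hh n
    have hf (n : ℕ) : Integrable (fun p : X × X =>
        |birkhoffAverage ℝ T f n p.1 - birkhoffAverage ℝ T f n p.2|) (μ.prod μ) :=
      (((integrable_birkhoffAverage hμ hfi n).comp_fst μ).sub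
        ((integrable_birkhoffAverage hμ hfi n).comp_snd μ)).abs
    have hbound (n : ℕ) (hn : 0 < n) : ∫ p : X × X, |u p.1 - u p.2| ∂μ.prod μ ≤
        ε + ∫ p : X × X,
          |birkhoffAverage ℝ T f n p.1 - birkhoffAverage ℝ T f n p.2| ∂μ.prod μ := by
      have hn0 : (n : ℝ) ≠ 0 := (Nat.cast_pos.2 hn).ne'
      -- By invariance `u` is its own average. The right side has integral `∫ |u - f| ≤ ε / 2`, for
      -- every `n > 0`.
      have hpt (x : X) : |u x - birkhoffAverage ℝ T f n x| ≤
          birkhoffAverage ℝ T (fun x => |u x - f x|) n x := by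
        refine le_trans (le_of_eq ?_) (abs_birkhoffAverage_le (fun x => u x - f x) n x)
        have h1 : birkhoffAverage ℝ T u n x = u x := by
          rw [birkhoffAverage_of_comp_eq ℝ hinv hn0]
        have h2 : birkhoffAverage ℝ T (fun x => u x - f x) n x =
            birkhoffAverage ℝ T u n x - birkhoffAverage ℝ T f n x :=
          congrFun (congrFun (birkhoffAverage_sub (R := ℝ) (f := T) (g := u) (g' := f)) n) x
        rw [h2, h1]
      have hAA : Integrable (fun p : X × X => birkhoffAverage ℝ T (fun x => |u x - f x|) n p.1 +
          birkhoffAverage ℝ T (fun x => |u x - f x|) n p.2) (μ.prod μ) :=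
        ((hA n).comp_fst μ).add ((hA n).comp_snd μ)
      have hsum : ∫ p : X × X, |u p.1 - u p.2| ∂μ.prod μ ≤
          ∫ p : X × X, ((birkhoffAverage ℝ T (fun x => |u x - f x|) n p.1 +
            birkhoffAverage ℝ T (fun x => |u x - f x|) n p.2) +
            |birkhoffAverage ℝ T f n p.1 - birkhoffAverage ℝ T f n p.2|) ∂μ.prod μ := by
        refine integral_mono hint (hAA.add (hf n)) ?_
        intro p
        have h1 := hpt p.1
        have h2 := hpt p.2
        rw [abs_le] at h1 h2
        have h3 := le_abs_self (birkhoffAverage ℝ T f n p.1 - birkhoffAverage ℝ T f n p.2)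
        have h4 := neg_abs_le (birkhoffAverage ℝ T f n p.1 - birkhoffAverage ℝ T f n p.2)
        exact abs_le.2 ⟨by linarith, by linarith⟩
      rw [integral_add hAA (hf n),
        integral_add ((hA n).comp_fst μ) ((hA n).comp_snd μ),
        integral_fun_fst (birkhoffAverage ℝ T (fun x => |u x - f x|) n),
        integral_fun_snd (birkhoffAverage ℝ T (fun x => |u x - f x|) n),
        integral_birkhoffAverage hμ hh hn] at hsum
      simp only [probReal_univ, one_smul] at hsum
      simp only [Real.norm_eq_abs] at hfε
      linarith
    have hlim := (tendsto_integral_abs_birkhoffAverage_sub hT hF f.continuous).const_add ε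
    rw [add_zero] at hlim
    rw [zero_add]
    refine ge_of_tendsto hlim ?_
    filter_upwards [eventually_gt_atTop 0] with n hn using hbound n hn
  have hzero := (integral_eq_zero_iff_of_nonneg (fun _ => abs_nonneg _) hint).1
    (hle.antisymm (integral_nonneg fun _ => abs_nonneg _))
  filter_upwards [hzero] with p hp
  simpa [sub_eq_zero] using hp

lemma ergodic_of_ae_weakMeanDist_eq_zero (hT : Continuous T) (hμ : MeasurePreserving T μ μ)
    (hF : ∀ᵐ p ∂μ.prod μ, weakMeanDist T p.1 p.2 = 0) : Ergodic T μ := by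
  refine ⟨hμ, ⟨fun s hs hsinv => ?_⟩⟩
  have hinv : s.indicator (1 : X → ℝ) ∘ T = s.indicator 1 := by
    ext x
    have : T x ∈ s ↔ x ∈ s := by rw [← Set.mem_preimage, hsinv]
    by_cases hx : x ∈ s <;> simp [this, hx]
  have hae := ae_eq_of_invariant hT hμ hF ((integrable_const (1 : ℝ)).indicator hs) hinv
  -- By Fubini, one fixed `x` agrees with almost every `y` on membership in `s`.
  obtain ⟨x, hx⟩ := (Measure.ae_ae_of_ae_prod hae).exists
  rw [eventuallyConst_set]
  by_cases hxs : x ∈ s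
  · left
    filter_upwards [hx] with y hy
    by_contra hys
    simp [hxs, hys] at hy
  · right
    filter_upwards [hx] with y hy hys
    simp [hxs, hys] at hy

end Converse

theorem theorem3p4 {X : Type*} [MetricSpace X] [CompactSpace X] [MeasurableSpace X] [BorelSpace X]
    (T : X → X) (hT : Continuous T)
    (μ : Measure X) [IsProbabilityMeasure μ] (hμ : MeasurePreserving T μ μ) :
    Ergodic T μ ↔ (μ.prod μ) {p : X × X | weakMeanDist T p.1 p.2 = 0} = 1 := by
  rw [← mem_ae_iff_prob_eq_one (measurableSet_weakMeanDist_eq_zero hT)]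
  exact ⟨fun h => h.ae_weakMeanDist_eq_zero, fun h => ergodic_of_ae_weakMeanDist_eq_zero hT hμ h⟩
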